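/- Let $p\ge 1$ be an integer. Lambda-terms are considered up to renaming of bound variables, i.e. as rooted plane unary-binary trees (leaves: variables, unary nodes: abstractions, binary nodes: applications) in which a leaf may be bound by (receive a pointer from) one of the unary nodes that are its ancestors; the term is closed if every leaf is bound by exactly one such node. The size of a term is its total number of nodes (leaves, unary nodes and binary nodes). Let $BCI(p)$ be the set of closed lambda-terms in which each unary node binds exactly $p$ leaves. For every $n\ge 0$ the number $g_n$ of $BCI(p)$-terms of size $n$ is finite, and the generating function $G_p(z)=\sum_{n\ge 0} g_n z^n$ satisfies, as an identity of formal power series over $\mathbb{Q}$, the differential equation $$G_p(z) = C_{p-1} z^{2p} + z\, G_p(z)^2 + \Delta_p G_p(z),$$ where $C_{p-1}=\frac1p\binom{2p-2}{p-1}$ is the Catalan number and $$\Delta_p=\sum_{l=1}^p \frac{\alpha_{l,p}}{l!}\, z^{l+2p+1} D^l,$$ with $D$ the formal derivative $d/dz$ and $$\alpha_{l,p} = \sum_{\substack{s_1,\dots,s_p\ge 0\\ \sum_i s_i = l,\ \sum_i i s_i = p}} \binom{l}{s_1, \dots, s_p} \prod_{m=1}^p \binom{2m}{m}^{s_m}.$$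 -/

import Mathlib

open PowerSeries

/-- Lambda-terms up to renaming of bound variables (equivalently, enriched unary-binary trees), in
de Bruijn notation: the leaf `var k` points to the `(k + 1)`-st unary node (`lam`) met on the path
from the leaf to the root; if there are at most `k` such nodes the leaf is free. -/
inductive LamTerm : Type
  | var : ℕ → LamTerm
  | lam : LamTerm → LamTerm
  | app : LamTerm → LamTerm → LamTerm

namespace LamTerm

/-- The size: the total number of nodes (leaves, unary nodes and binary nodes). -/
def size : LamTerm → ℕ
  | var _ => 1
  | lam t => t.size + 1
  | app t u => t.size + u.size + 1

/-- `t.ClosedUnder k`: every leaf of `t` is bound once `k` unary nodes are placed above `t`. -/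
def ClosedUnder : LamTerm → ℕ → Prop
  | var i, k => i < k
  | lam t, k => t.ClosedUnder (k + 1)
  | app t u, k => t.ClosedUnder k ∧ u.ClosedUnder k

/-- Closed terms: every leaf is bound by a unary node of the term. -/
def IsClosed (t : LamTerm) : Prop := t.ClosedUnder 0

/-- `t.occ k`: the number of leaves of `t` that would be bound by the `(k + 1)`-st of the unary
nodes placed above `t` (counted upwards); so `t.occ 0` is the number of leaves that the root of
`lam t` binds. -/
def occ : LamTerm → ℕ → ℕ
  | var i, k => if i = k then 1 else 0
  | lam t, k => t.occ (k + 1)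
  | app t u, k => t.occ k + u.occ k

/-- Every unary node of the term binds exactly `p` leaves. -/
def EachBinds (p : ℕ) : LamTerm → Prop
  | var _ => True
  | lam t => t.occ 0 = p ∧ t.EachBinds p
  | app t u => t.EachBinds p ∧ u.EachBinds p

end LamTerm

/-- `BCI(p)`: the closed lambda-terms in which each unary node binds exactly `p` leaves. -/
def BCI (p : ℕ) : Set LamTerm := {t | t.IsClosed ∧ t.EachBinds p}

/-- The set of `BCI(p)`-terms of size `n`. -/
def BCIOfSize (p n : ℕ) : Set LamTerm := {t | t ∈ BCI p ∧ t.size = n}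

/-- The generating function `G_p(z) = ∑ₙ gₙ zⁿ`, `gₙ` the number of `BCI(p)`-terms of size `n`. -/
noncomputable def bciGF (p : ℕ) : ℚ⟦X⟧ :=
  PowerSeries.mk fun n => ((BCIOfSize p n).ncard : ℚ)

/-- The constants `α_{l,p}`: the sum over all `(s_1, …, s_p)` of natural numbers with
`∑ s_i = l` and `∑ i s_i = p`. The entry `s i` for `i : Fin p` is `s_{i+1}`. -/
def bciAlpha (l p : ℕ) : ℕ :=
  ∑ s ∈ (Finset.piAntidiag (Finset.univ : Finset (Fin p)) l).filter
      (fun s => ∑ i : Fin p, ((i : ℕ) + 1) * s i = p),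
    Nat.multinomial Finset.univ s *
      ∏ i : Fin p, ((2 * ((i : ℕ) + 1)).choose ((i : ℕ) + 1)) ^ s i

/-- The differential operator `Δ_p = ∑_{l=1}^p (α_{l,p} / l!) z^{l+2p+1} D^l` on formal power
series, `D` the formal derivative. -/
noncomputable def bciDelta (p : ℕ) (F : ℚ⟦X⟧) : ℚ⟦X⟧ :=
  ∑ l ∈ Finset.Icc 1 p,
    ((bciAlpha l p : ℚ) / (Nat.factorial l : ℚ)) •
      ((X : ℚ⟦X⟧) ^ (l + 2 * p + 1) * (fun H : ℚ⟦X⟧ => d⁄dX ℚ H)^[l] F)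

/-!
A term of `BCI(p)` is either an application of two such terms, which gives `z G²`, or `lam u`, where
`p` leaves of `u` are bound by the root. Erase these `p` leaves from `u`, contracting the binary node
above each of them (`LamTerm.strip`). If nothing remains, `u` is a binary tree with `p` leaves, and
there are `C_{p-1}` of these, of size `2p - 1`. Otherwise a term `t` of `BCI(p)` remains, with
`t.size + 2 * p = u.size` (`LamTerm.of_strip_eq_some`).

Conversely, the terms `u` that reduce to a given `t` arise by hanging on every edge of `t`, the edge
above the root included, a sequence of binary trees, each to the left or to the right. With `B` the
series of binary trees by leaves, so that `B = X + B²`, one edge contributes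
`S = 1 / (1 - 2B) = 1 / √(1 - 4X)`, the series of the central binomial coefficients. Since `t` has as
many edges as nodes, the terms over `t` are counted by `S ^ t.size` (`LamTerm.hasGF_strip_eq_some`).
That lemma is an induction on `t`: looking at the root of `u` shows that the series `N_t` of the terms
over `t` satisfies `N_t = 2 B N_t + T_t`, where `T_t` is `1` for a leaf, `N_a` for `t = lam a` and
`N_a N_b` for `t = app a b`.

The coefficient of `X ^ p` in `S ^ n = (1 + (S - 1)) ^ n` is `∑_l (n choose l) α_{l,p}`, by the
binomial and the multinomial theorem, and multiplying `[zⁿ] F` by `n choose l` is applying `z ^ l D ^ l / l!`;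
this is how `Δ_p` appears (`coeff_bciDelta`).
-/

/-! ### Generating functions of weighted sets -/

/-- `F` is the generating function of the set `A` with respect to the weight `w`: for every `n` the
elements of weight `n` are finite in number and counted by the `n`-th coefficient of `F`. -/
def HasGF {α : Type*} (A : Set α) (w : α → ℕ) (F : ℚ⟦X⟧) : Prop :=
  ∀ n, {a ∈ A | w a = n}.Finite ∧ (({a ∈ A | w a = n}.ncard : ℕ) : ℚ) = coeff n F

namespace HasGF

variable {α β γ : Type*} {A B : Set α} {w : α → ℕ} {F G : ℚ⟦X⟧}

theorem unique (h : HasGF A w F) (h' : HasGF A w G) : F = G := by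
  ext n
  rw [← (h n).2, ← (h' n).2]

theorem of_finite (h : ∀ n, {a ∈ A | w a = n}.Finite) :
    HasGF A w (PowerSeries.mk fun n => (({a ∈ A | w a = n}.ncard : ℕ) : ℚ)) :=
  fun n => ⟨h n, by simp⟩

theorem singleton (a : α) : HasGF {a} w (X ^ w a) := by
  intro n
  by_cases h : n = w a
  · have : {b ∈ ({a} : Set α) | w b = n} = {a} := by
      ext b
      simp only [Set.mem_ofPred_eq, Set.mem_singleton_iff, and_iff_left_iff_imp]
      rintro rfl
      exact h.symm
    rw [this]
    simp [coeff_X_pow, h]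
  · have : {b ∈ ({a} : Set α) | w b = n} = ∅ := by
      ext b
      simp only [Set.mem_ofPred_eq, Set.mem_singleton_iff, Set.mem_empty_iff_false, iff_false]
      rintro ⟨rfl, hb⟩
      exact h hb.symm
    rw [this]
    simp [coeff_X_pow, h]

theorem union (hA : HasGF A w F) (hB : HasGF B w G) (hAB : Disjoint A B) :
    HasGF (A ∪ B) w (F + G) := by
  intro n
  have e : {a ∈ A ∪ B | w a = n} = {a ∈ A | w a = n} ∪ {a ∈ B | w a = n} := by
    ext a
    simp only [Set.mem_ofPred_eq, Set.mem_union]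
    tauto
  have hd : Disjoint {a ∈ A | w a = n} {a ∈ B | w a = n} :=
    hAB.mono (fun a ha => ha.1) (fun a ha => ha.1)
  rw [e, Set.ncard_union_eq hd (hA n).1 (hB n).1]
  refine ⟨(hA n).1.union (hB n).1, ?_⟩
  rw [map_add, ← (hA n).2, ← (hB n).2, Nat.cast_add]

theorem image {f : α → β} {w' : β → ℕ} {c : ℕ} (hA : HasGF A w F) (hf : Function.Injective f)
    (hw : ∀ a ∈ A, w' (f a) = w a + c) : HasGF (f '' A) w' (X ^ c * F) := by
  intro n
  by_cases hn : c ≤ n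
  · have e : {b ∈ f '' A | w' b = n} = f '' {a ∈ A | w a = n - c} := by
      ext b
      constructor
      · rintro ⟨⟨a, ha, rfl⟩, hb⟩
        rw [hw a ha] at hb
        exact ⟨a, ⟨ha, by omega⟩, rfl⟩
      · rintro ⟨a, ⟨ha, hb⟩, rfl⟩
        exact ⟨⟨a, ha, rfl⟩, by rw [hw a ha]; omega⟩
    rw [e, Set.ncard_image_of_injective _ hf, coeff_X_pow_mul', if_pos hn]
    exact ⟨(hA _).1.image f, (hA _).2⟩
  · have e : {b ∈ f '' A | w' b = n} = ∅ := by
      ext b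
      simp only [Set.mem_empty_iff_false, iff_false]
      rintro ⟨⟨a, ha, rfl⟩, hb⟩
      rw [hw a ha] at hb
      omega
    rw [e, coeff_X_pow_mul', if_neg hn]
    simp

theorem prod {C : Set β} {v : β → ℕ} (hA : HasGF A w F) (hC : HasGF C v G) :
    HasGF (A ×ˢ C) (fun x => w x.1 + v x.2) (F * G) := by
  classical
  intro n
  have e : {x ∈ A ×ˢ C | w x.1 + v x.2 = n} =
      ⋃ ij ∈ (Finset.HasAntidiagonal.antidiagonal n : Finset (ℕ × ℕ)),
        {a ∈ A | w a = ij.1} ×ˢ {b ∈ C | v b = ij.2} := by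
    ext ⟨a, b⟩
    simp only [Set.mem_ofPred_eq, Set.mem_prod, Set.mem_iUnion, Finset.HasAntidiagonal.mem_antidiagonal,
      exists_prop, Prod.exists]
    constructor
    · rintro ⟨⟨ha, hb⟩, h⟩
      exact ⟨_, _, h, ⟨ha, rfl⟩, hb, rfl⟩
    · rintro ⟨i, j, h, ⟨ha, rfl⟩, hb, rfl⟩
      exact ⟨⟨ha, hb⟩, h⟩
  have hfin : ∀ ij : ℕ × ℕ, ({a ∈ A | w a = ij.1} ×ˢ {b ∈ C | v b = ij.2}).Finite :=
    fun ij => (hA _).1.prod (hC _).1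
  refine ⟨by rw [e]; exact Set.Finite.biUnion (Finset.finite_toSet _) fun ij _ => hfin ij, ?_⟩
  have e' : {x ∈ A ×ˢ C | w x.1 + v x.2 = n} =
      (((Finset.HasAntidiagonal.antidiagonal n).biUnion fun ij => (hfin ij).toFinset : Finset (α × β)) :
        Set (α × β)) := by
    rw [e]
    ext x
    simp
  rw [e', Set.ncard_coe_finset, Finset.card_biUnion, coeff_mul, Nat.cast_sum]
  · refine Finset.sum_congr rfl fun ij _ => ?_
    rw [← Set.ncard_eq_toFinset_card _ (hfin ij), Set.ncard_prod, Nat.cast_mul, (hA _).2, (hC _).2]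
  · rintro ⟨i, j⟩ _ ⟨i', j'⟩ _ hne
    refine Finset.disjoint_left.2 ?_
    rintro ⟨a, b⟩ h1 h2
    simp only [Set.Finite.mem_toFinset, Set.mem_prod, Set.mem_ofPred_eq] at h1 h2
    exact hne (Prod.ext (h1.1.2.symm.trans h2.1.2) (h1.2.2.symm.trans h2.2.2))

theorem image2 {C : Set β} {v : β → ℕ} {f : α → β → γ} {u : γ → ℕ} {c : ℕ} (hA : HasGF A w F)
    (hC : HasGF C v G) (hf : Function.Injective2 f) (hu : ∀ a b, u (f a b) = w a + v b + c) :
    HasGF (Set.image2 f A C) u (X ^ c * (F * G)) := by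
  rw [← Set.image_prod]
  exact (hA.prod hC).image hf.uncurry fun x _ => hu x.1 x.2

end HasGF

/-! ### The series of binary trees and of central binomial coefficients -/

/-- The series `∑ₘ (2m choose m) Xᵐ`, that is `1 / √(1 - 4X)`. -/
noncomputable def centralSeries : ℚ⟦X⟧ := PowerSeries.mk fun n => (n.centralBinom : ℚ)

/-- The coefficients of `1 / √(1 - 4X)` satisfy the recurrence of the central binomial coefficients,
because `S ^ 2 * (1 - 4X) = 1` implies `(1 - 4X) * S' = 2 * S`. -/
theorem eq_centralSeries_of_sq_mul {S : ℚ⟦X⟧} (h0 : constantCoeff S = 1)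
    (h : S ^ 2 * (1 - 4 * X) = 1) : S = centralSeries := by
  have e2 : (2 : ℚ⟦X⟧) = C 2 := (map_ofNat C 2).symm
  have e4 : (4 : ℚ⟦X⟧) = C 4 := (map_ofNat C 4).symm
  have hS : 2 * S ≠ 0 := by
    intro hS
    have := congrArg constantCoeff hS
    rw [e2, map_mul, h0, constantCoeff_C, map_zero] at this
    norm_num at this
  have hD : d⁄dX ℚ S * (1 - 4 * X) = 2 * S := by
    have h4 : d⁄dX ℚ (4 * X : ℚ⟦X⟧) = 4 := by
      rw [e4, Derivation.leibniz, derivative_C, derivative_X]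
      simp
    have := congrArg (d⁄dX ℚ) h
    rw [Derivation.leibniz, derivative_pow, map_sub, h4, derivative_one] at this
    simp only [smul_eq_mul] at this
    have h2 : (2 * S) * (d⁄dX ℚ S * (1 - 4 * X)) = (2 * S) * (2 * S) := by
      push_cast at this
      linear_combination this
    exact mul_left_cancel₀ hS h2
  ext n
  rw [centralSeries, coeff_mk]
  induction n with
  | zero => simpa using h0
  | succ n ih =>
    have h1 : coeff n (d⁄dX ℚ S * (1 - 4 * X)) =
        coeff (n + 1) S * (n + 1) - 4 * (n * coeff n S) := by
      rw [mul_sub, mul_one, map_sub, coeff_derivative,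
        show d⁄dX ℚ S * (4 * X) = (C (4 : ℚ) * d⁄dX ℚ S) * X by rw [e4]; ring]
      congr 1
      cases n with
      | zero => simp
      | succ m =>
        rw [coeff_succ_mul_X, coeff_C_mul, coeff_derivative]
        push_cast
        ring
    have h2 : coeff n (2 * S) = 2 * coeff n S := by
      rw [e2, coeff_C_mul]
    rw [hD, h2, ih] at h1
    have h3 : ((n : ℚ) + 1) * ((n + 1).centralBinom : ℚ) = 2 * (2 * n + 1) * n.centralBinom := by
      exact_mod_cast Nat.succ_mul_centralBinom_succ n
    have h4 : (n : ℚ) + 1 ≠ 0 := by positivity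
    refine mul_left_cancel₀ h4 ?_
    linear_combination -h1 - h3

/-- The series `∑_{m ≥ 1} C_{m-1} Xᵐ` of plane binary trees counted by leaves. -/
noncomputable def binaryTreeSeries : ℚ⟦X⟧ := X * catalanSeries.map (Nat.castRingHom ℚ)

theorem binaryTreeSeries_eq :
    binaryTreeSeries = X + binaryTreeSeries * binaryTreeSeries := by
  have := congrArg (PowerSeries.map (Nat.castRingHom ℚ)) catalanSeries_sq_mul_X_add_one
  simp only [map_add, map_mul, map_pow, map_X, map_one] at this
  rw [binaryTreeSeries]
  linear_combination -X * this

/-- `1 / √(1 - 4X) = 1 / (1 - 2B)` for the series `B` of binary trees: it counts the sequences of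
binary trees, each hanging to the left or to the right. -/
theorem centralSeries_eq :
    centralSeries = 1 + 2 * binaryTreeSeries * centralSeries := by
  have hBeq := binaryTreeSeries_eq
  have h0 : constantCoeff (1 - 2 * binaryTreeSeries) = 1 := by simp [binaryTreeSeries]
  have hinv : (1 - 2 * binaryTreeSeries) * (1 - 2 * binaryTreeSeries)⁻¹ = 1 :=
    PowerSeries.mul_inv_cancel _ (by rw [h0]; exact one_ne_zero)
  have hS : (1 - 2 * binaryTreeSeries)⁻¹ = centralSeries := by
    refine eq_centralSeries_of_sq_mul (by rw [constantCoeff_inv, h0, inv_one]) ?_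
    have : (1 - 2 * binaryTreeSeries) ^ 2 = 1 - 4 * X := by linear_combination (-4) * hBeq
    rw [← this, ← mul_pow, mul_comm, hinv, one_pow]
  rw [hS] at hinv
  linear_combination hinv

/-! ### Expansion of the powers of the central binomial series -/

theorem X_dvd_centralSeries_sub_one : X ∣ centralSeries - 1 := by
  rw [X_dvd_iff, map_sub, ← coeff_zero_eq_constantCoeff_apply]
  simp [centralSeries]

/-- The constants `α_{l,p}` are coefficients of the powers of the series `∑_{m ≥ 1} (2m choose m) Xᵐ`:
they count the ways of hanging `p` leaves on `l` given edges, every edge being used. -/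
theorem coeff_centralSeries_sub_one_pow (l p : ℕ) :
    coeff p ((centralSeries - 1) ^ l) = (bciAlpha l p : ℚ) := by
  set Q : ℚ⟦X⟧ := ∑ i : Fin p,
    C (((2 * ((i : ℕ) + 1)).choose ((i : ℕ) + 1) : ℕ) : ℚ) * X ^ ((i : ℕ) + 1) with hQ
  -- Only the terms of degree at most `p` matter.
  have hdvd : X ^ (p + 1) ∣ (centralSeries - 1) - Q := by
    rw [X_pow_dvd_iff]
    intro m hm
    rw [map_sub, map_sub, hQ, map_sum]
    simp only [coeff_C_mul, coeff_X_pow, mul_ite, mul_one, mul_zero]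
    rcases m with _ | m
    · simp [centralSeries]
    · have hm' : m < p := by omega
      rw [Finset.sum_eq_single ⟨m, hm'⟩]
      · simp [centralSeries, coeff_one, Nat.centralBinom_eq_two_mul_choose]
      · intro i _ hi
        rw [if_neg]
        intro h
        exact hi (Fin.ext (by simp; omega))
      · simp
  have hpow : coeff p ((centralSeries - 1) ^ l) = coeff p (Q ^ l) := by
    have := X_pow_dvd_iff.1 (hdvd.trans (sub_dvd_pow_sub_pow _ _ l)) p (Nat.lt_succ_self p)
    rwa [map_sub, sub_eq_zero] at this
  rw [hpow, hQ, Finset.sum_pow_eq_sum_piAntidiag, map_sum, bciAlpha, Finset.sum_filter,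
    Nat.cast_sum]
  refine Finset.sum_congr rfl fun s _ => ?_
  have hprod : ∏ i : Fin p,
      (C (((2 * ((i : ℕ) + 1)).choose ((i : ℕ) + 1) : ℕ) : ℚ) * X ^ ((i : ℕ) + 1) : ℚ⟦X⟧) ^ s i =
      C (∏ i : Fin p, (((2 * ((i : ℕ) + 1)).choose ((i : ℕ) + 1) : ℕ) : ℚ) ^ s i) *
        X ^ (∑ i : Fin p, ((i : ℕ) + 1) * s i) := by
    simp only [mul_pow, Finset.prod_mul_distrib, map_prod, map_pow, ← pow_mul,
      Finset.prod_pow_eq_pow_sum]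
  rw [hprod, show ((Nat.multinomial Finset.univ s : ℕ) : ℚ⟦X⟧) =
    C ((Nat.multinomial Finset.univ s : ℕ) : ℚ) by simp, coeff_C_mul, coeff_C_mul, coeff_X_pow]
  by_cases h : ∑ i : Fin p, ((i : ℕ) + 1) * s i = p
  · rw [if_pos h, if_pos h.symm]
    push_cast
    ring
  · rw [if_neg h, if_neg (Ne.symm h)]
    simp

theorem coeff_centralSeries_pow {p : ℕ} (hp : 1 ≤ p) (n : ℕ) :
    coeff p (centralSeries ^ n) = ∑ l ∈ Finset.Icc 1 p, (n.choose l : ℚ) * bciAlpha l p := by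
  have h1 : centralSeries ^ n =
      ∑ l ∈ Finset.range (n + 1), C (n.choose l : ℚ) * (centralSeries - 1) ^ l := by
    conv_lhs => rw [← sub_add_cancel centralSeries 1, add_pow]
    exact Finset.sum_congr rfl fun l _ => by simp [mul_comm]
  rw [h1, map_sum]
  simp only [coeff_C_mul, coeff_centralSeries_sub_one_pow]
  have hout : ∀ l, l ∉ Finset.Icc 1 p → (bciAlpha l p : ℚ) = 0 := by
    intro l hl
    rw [← coeff_centralSeries_sub_one_pow]
    rcases Nat.eq_zero_or_pos l with rfl | hl'
    · rw [pow_zero, coeff_one, if_neg (by omega)]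
    · rw [Finset.mem_Icc, not_and] at hl
      exact X_pow_dvd_iff.1 (pow_dvd_pow_of_dvd X_dvd_centralSeries_sub_one l) p
        (not_le.1 (hl hl'))
  rw [Finset.sum_subset (Finset.range_subset_range.2 (Nat.le_add_right (n + 1) p))
    (f := fun l => (n.choose l : ℚ) * bciAlpha l p)]
  · refine (Finset.sum_subset ?_ fun l _ hl => by rw [hout l hl, mul_zero]).symm
    intro l hl
    rw [Finset.mem_Icc] at hl
    rw [Finset.mem_range]
    omega
  · intro l _ hl
    rw [Nat.choose_eq_zero_of_lt (by simpa using hl), Nat.cast_zero, zero_mul]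

/-- On coefficients, `Δ_p` multiplies by a coefficient of a power of the central binomial series. -/
theorem coeff_bciDelta {p : ℕ} (hp : 1 ≤ p) (F : ℚ⟦X⟧) (n : ℕ) :
    coeff n (bciDelta p F) = if 2 * p + 1 ≤ n then
      coeff p (centralSeries ^ (n - (2 * p + 1))) * coeff (n - (2 * p + 1)) F else 0 := by
  rw [bciDelta, map_sum]
  simp only [coeff_smul, coeff_X_pow_mul']
  split_ifs with hn
  · obtain ⟨m, rfl⟩ := Nat.exists_eq_add_of_le' hn
    rw [Nat.add_sub_cancel, coeff_centralSeries_pow hp, Finset.sum_mul]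
    refine Finset.sum_congr rfl fun l _ => ?_
    by_cases hl : l ≤ m
    · obtain ⟨k, rfl⟩ := Nat.exists_eq_add_of_le' hl
      rw [if_pos (by omega), show k + l + (2 * p + 1) - (l + 2 * p + 1) = k by omega]
      have h := coeff_iterate_derivative F l k
      have hc : ((k + 1).ascFactorial l : ℚ) = l.factorial * (k + l).choose l := by
        exact_mod_cast Nat.ascFactorial_eq_factorial_mul_choose k l
      have hl0 : (l.factorial : ℚ) ≠ 0 := by positivity
      have h' : coeff k ((fun H : ℚ⟦X⟧ => d⁄dX ℚ H)^[l] F) =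
          l.factorial * (k + l).choose l * coeff (k + l) F := by
        rw [← hc]
        simpa [nsmul_eq_mul] using h
      rw [h', smul_eq_mul]
      field_simp
    · rw [if_neg (by omega), Nat.choose_eq_zero_of_lt (by omega)]
      simp
  · refine Finset.sum_eq_zero fun l _ => ?_
    rw [if_neg (by omega), smul_zero]

namespace LamTerm

/-! ### Erasing the occurrences of a variable -/

/-- `t.strip k` erases all the leaves `var k` that point outside of `t` (the index is shifted under
unary nodes), contracting the binary nodes that lose an argument; the result is `none` if nothing is
left. A unary node whose whole body would vanish keeps a single leaf; this value is immaterial, as it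
does not occur for terms in which every unary node binds a leaf, and it has the effect that the
result is `none` exactly for the binary trees all of whose leaves are `var k`. The indices of the
other leaves are kept, which is right when `k` is the outermost variable, as in a term closed under
`k + 1`. -/
def strip : LamTerm → ℕ → Option LamTerm
  | var i, k => if i = k then none else some (var i)
  | lam t, k => some (lam ((t.strip (k + 1)).getD (var (k + 1))))
  | app t u, k => Option.merge app (t.strip k) (u.strip k)

theorem strip_app_eq_none {t u : LamTerm} {k : ℕ} :
    (app t u).strip k = none ↔ t.strip k = none ∧ u.strip k = none := by
  rw [strip]
  cases t.strip k <;> cases u.strip k <;> simp [Option.merge]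

theorem strip_app_eq_some {t u r : LamTerm} {k : ℕ} :
    (app t u).strip k = some r ↔ (t.strip k = none ∧ u.strip k = some r) ∨
      (t.strip k = some r ∧ u.strip k = none) ∨
      ∃ a b, t.strip k = some a ∧ u.strip k = some b ∧ r = app a b := by
  rw [strip]
  cases t.strip k <;> cases u.strip k <;> simp [Option.merge, eq_comm]

theorem strip_lam_eq_some {t r : LamTerm} {k : ℕ} (hr : r.ClosedUnder k) :
    (lam t).strip k = some r ↔ ∃ a, r = lam a ∧ t.strip (k + 1) = some a := by
  rw [strip]
  cases h : t.strip (k + 1) with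
  | none =>
    simp only [Option.getD_none, Option.some.injEq, reduceCtorEq, and_false, exists_false,
      iff_false]
    rintro rfl
    exact lt_irrefl _ hr
  | some a => simp [eq_comm]

/-- A term that is erased entirely is a binary tree with leaves `var k`. -/
theorem of_strip_eq_none (p : ℕ) {u : LamTerm} {k : ℕ} (h : u.strip k = none) :
    u.ClosedUnder (k + 1) ∧ u.EachBinds p ∧ u.size + 1 = 2 * u.occ k ∧
      ∀ j, j ≠ k → u.occ j = 0 := by
  induction u with
  | var i =>
    have hi : i = k := by
      by_contra hi
      simp [strip, hi] at h
    subst hi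
    refine ⟨Nat.lt_succ_self _, trivial, by simp [size, occ], fun j hj => ?_⟩
    simp [occ, hj.symm]
  | lam t => simp [strip] at h
  | app t u iht ihu =>
    rw [strip_app_eq_none] at h
    obtain ⟨a1, a2, a3, a4⟩ := iht h.1
    obtain ⟨b1, b2, b3, b4⟩ := ihu h.2
    refine ⟨⟨a1, b1⟩, ⟨a2, b2⟩, ?_, fun j hj => ?_⟩
    · simp only [size, occ]
      omega
    · simp only [occ, a4 j hj, b4 j hj]

/-- What erasing does to a term `u`: each erased leaf takes a binary node with it, and nothing else is
changed. -/
theorem of_strip_eq_some (p : ℕ) {u t : LamTerm} {k : ℕ} (h : u.strip k = some t)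
    (ht : t.ClosedUnder k) :
    u.ClosedUnder (k + 1) ∧ (u.EachBinds p ↔ t.EachBinds p) ∧ u.size = t.size + 2 * u.occ k ∧
      ∀ j, j ≠ k → u.occ j = t.occ j := by
  induction u generalizing t k with
  | var i =>
    by_cases hi : i = k
    · simp [strip, hi] at h
    · simp only [strip, hi, if_false, Option.some.injEq] at h
      subst h
      exact ⟨Nat.lt_succ_of_lt ht, Iff.rfl, by simp [occ, hi], fun _ _ => rfl⟩
  | lam u ih =>
    obtain ⟨a, rfl, ha⟩ := (strip_lam_eq_some ht).1 h
    obtain ⟨h1, h2, h3, h4⟩ := ih ha ht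
    refine ⟨h1, ?_, ?_, fun j hj => h4 _ (by omega)⟩
    · rw [EachBinds, EachBinds, h2, h4 0 (by omega)]
    · simp only [size, occ]
      omega
  | app u v ihu ihv =>
    rcases strip_app_eq_some.1 h with ⟨hu, hv⟩ | ⟨hu, hv⟩ | ⟨a, b, hu, hv, rfl⟩
    · obtain ⟨a1, a2, a3, a4⟩ := of_strip_eq_none p hu
      obtain ⟨b1, b2, b3, b4⟩ := ihv hv ht
      refine ⟨⟨a1, b1⟩, ?_, ?_, fun j hj => ?_⟩
      · rw [EachBinds, b2, and_iff_right a2]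
      · simp only [size, occ]
        omega
      · simp only [occ, a4 j hj, b4 j hj, zero_add]
    · obtain ⟨a1, a2, a3, a4⟩ := of_strip_eq_none p hv
      obtain ⟨b1, b2, b3, b4⟩ := ihu hu ht
      refine ⟨⟨b1, a1⟩, ?_, ?_, fun j hj => ?_⟩
      · rw [EachBinds, b2, and_iff_left a2]
      · simp only [size, occ]
        omega
      · simp only [occ, a4 j hj, b4 j hj, add_zero]
    · obtain ⟨a1, a2, a3, a4⟩ := ihu hu ht.1
      obtain ⟨b1, b2, b3, b4⟩ := ihv hv ht.2
      refine ⟨⟨a1, b1⟩, ?_, ?_, fun j hj => ?_⟩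
      · rw [EachBinds, EachBinds, a2, b2]
      · simp only [size, occ]
        omega
      · simp only [occ, a4 j hj, b4 j hj]

/-- If every unary node binds a leaf, erasing the last of `k + 1` outer variables leaves a term in the
`k` others. -/
theorem closedUnder_of_strip_eq_some {p : ℕ} (hp : 1 ≤ p) {u t : LamTerm} {k : ℕ}
    (h : u.strip k = some t) (hc : u.ClosedUnder (k + 1)) (hb : u.EachBinds p) :
    t.ClosedUnder k := by
  induction u generalizing t k with
  | var i =>
    by_cases hi : i = k
    · simp [strip, hi] at h
    · simp only [strip, hi, if_false, Option.some.injEq] at h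
      subst h
      exact lt_of_le_of_ne (Nat.le_of_lt_succ hc) hi
  | lam u ih =>
    cases hu : u.strip (k + 1) with
    | none =>
      have := (of_strip_eq_none p hu).2.2.2 0 (by omega)
      have := hb.1
      omega
    | some a =>
      simp only [strip, hu, Option.getD_some, Option.some.injEq] at h
      subst h
      change a.ClosedUnder (k + 1)
      exact ih hu hc hb.2
  | app u v ihu ihv =>
    rcases strip_app_eq_some.1 h with ⟨_, hv⟩ | ⟨hu, _⟩ | ⟨a, b, hu, hv, rfl⟩
    · exact ihv hv hc.2 hb.2
    · exact ihu hu hc.1 hb.1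
    · exact ⟨ihu hu hc.1 hb.1, ihv hv hc.2 hb.2⟩

theorem app_injective2 : Function.Injective2 app := fun _ _ _ _ h => by
  injection h with h1 h2
  exact ⟨h1, h2⟩

theorem lam_injective : Function.Injective lam := fun _ _ h => by
  injection h

theorem size_pos (t : LamTerm) : 0 < t.size := by
  cases t <;> simp [size]

theorem finite_closedUnder_size_le (n : ℕ) :
    ∀ m, {t : LamTerm | t.ClosedUnder m ∧ t.size ≤ n}.Finite := by
  induction n with
  | zero =>
    intro m
    refine Set.Finite.subset Set.finite_empty fun t ht => ?_
    have := t.size_pos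
    have := ht.2
    omega
  | succ n ih =>
    intro m
    refine Set.Finite.subset (((Set.finite_Iio m).image var).union
      (((ih (m + 1)).image lam).union ((ih m).image2 app (ih m)))) ?_
    rintro (i | t | ⟨t, u⟩) ⟨hc, hs⟩
    · exact Or.inl ⟨i, hc, rfl⟩
    · exact Or.inr (Or.inl ⟨t, ⟨hc, Nat.le_of_succ_le_succ hs⟩, rfl⟩)
    · simp only [size] at hs
      exact Or.inr (Or.inr ⟨t, ⟨hc.1, by omega⟩, u, ⟨hc.2, by omega⟩, rfl⟩)

/-! ### Counting the terms with a given erasure -/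

/-- The binary trees with leaves `var k`, counted by leaves: the solution of `B = X + B ^ 2`. -/
theorem hasGF_strip_eq_none (k : ℕ) :
    HasGF {u : LamTerm | u.strip k = none} (fun u => u.occ k)
      binaryTreeSeries := by
  set P := {u : LamTerm | u.strip k = none} with hP
  have hfin : ∀ n, {u ∈ P | u.occ k = n}.Finite := fun n =>
    (finite_closedUnder_size_le (2 * n) (k + 1)).subset fun u hu => by
      obtain ⟨h1, _, h3, _⟩ := of_strip_eq_none 0 hu.1
      have := hu.2
      exact ⟨h1, by omega⟩
  have hB := HasGF.of_finite hfin
  set B : ℚ⟦X⟧ := PowerSeries.mk fun n => (({u ∈ P | u.occ k = n}.ncard : ℕ) : ℚ) with hBdef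
  have hdec : P = {var k} ∪ Set.image2 app P P := by
    ext u
    constructor
    · intro hu
      cases u with
      | var i =>
        have hi : i = k := by
          by_contra hi
          simp [hP, strip, hi] at hu
        exact Or.inl (by rw [hi]; rfl)
      | lam t => simp [hP, strip] at hu
      | app t u =>
        obtain ⟨h1, h2⟩ := strip_app_eq_none.1 hu
        exact Or.inr ⟨t, h1, u, h2, rfl⟩
    · rintro (rfl | ⟨t, ht, u, hu, rfl⟩)
      · simp [hP, strip]
      · exact strip_app_eq_none.2 ⟨ht, hu⟩
  have hsum : HasGF P (fun u => u.occ k) (X ^ (var k).occ k + X ^ 0 * (B * B)) := by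
    rw [hdec]
    refine (HasGF.singleton (w := fun u => u.occ k) (var k)).union
      (hB.image2 (c := 0) hB app_injective2 fun _ _ => rfl) ?_
    rw [Set.disjoint_left]
    rintro _ rfl ⟨_, _, _, _, h⟩
    cases h
  have hBeq : B = X + B * B := by simpa [occ] using hB.unique hsum
  have hDeq := binaryTreeSeries_eq
  have hB0 : constantCoeff B = 0 := by
    rw [← coeff_zero_eq_constantCoeff_apply, hBdef, coeff_mk, Nat.cast_eq_zero,
      Set.ncard_eq_zero (hfin 0)]
    ext u
    simp only [Set.mem_ofPred_eq, Set.mem_empty_iff_false, iff_false]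
    rintro ⟨hu, h0⟩
    have := (of_strip_eq_none 0 hu).2.2.1
    omega
  -- The two solutions without constant term agree, as `1 - B - binaryTreeSeries` is a unit.
  have hmul : (B - binaryTreeSeries) * (1 - B - binaryTreeSeries) = 0 := by
    linear_combination hBeq - hDeq
  have hne : (1 - B - binaryTreeSeries) ≠ 0 := by
    intro h
    have := congrArg constantCoeff h
    simp [hB0, binaryTreeSeries] at this
  have : B = binaryTreeSeries := sub_eq_zero.1 ((mul_eq_zero.1 hmul).resolve_right hne)
  rwa [this] at hB

/-- If the terms over `t` are those of a set `T` and those obtained from other terms over `t` by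
hanging a binary tree to the left or to the right of the root, then passing from `T` to all terms
over `t` multiplies the generating function by `1 / (1 - 2B)`. -/
theorem hasGF_strip_eq_some_of_root {t : LamTerm} {k : ℕ} (ht : t.ClosedUnder k)
    {T : Set LamTerm} {F : ℚ⟦X⟧} (hT : HasGF T (fun u => u.occ k) F)
    (hdec : {u : LamTerm | u.strip k = some t} = T ∪
      (Set.image2 app {u | u.strip k = none} {u | u.strip k = some t} ∪
        Set.image2 app {u | u.strip k = some t} {u | u.strip k = none}))
    (hdisj : ∀ a b, app a b ∈ T → a.strip k ≠ none ∧ b.strip k ≠ none) :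
    HasGF {u : LamTerm | u.strip k = some t} (fun u => u.occ k) (centralSeries * F) := by
  set W := {u : LamTerm | u.strip k = some t}
  have hP := hasGF_strip_eq_none k
  set P := {u : LamTerm | u.strip k = none}
  have hfin : ∀ n, {u ∈ W | u.occ k = n}.Finite := fun n =>
    (finite_closedUnder_size_le (t.size + 2 * n) (k + 1)).subset fun u hu => by
      obtain ⟨h1, _, h3, _⟩ := of_strip_eq_some 0 hu.1 ht
      have := hu.2
      exact ⟨h1, by omega⟩
  have hN := HasGF.of_finite hfin
  set N : ℚ⟦X⟧ := PowerSeries.mk fun n => (({u ∈ W | u.occ k = n}.ncard : ℕ) : ℚ)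
  have hocc : ∀ a b : LamTerm, (app a b).occ k = a.occ k + b.occ k + 0 := fun _ _ => rfl
  have hsum : HasGF W (fun u => u.occ k)
      (F + (X ^ 0 * (binaryTreeSeries * N) + X ^ 0 * (N * binaryTreeSeries))) := by
    rw [hdec]
    refine hT.union ((hP.image2 hN app_injective2 hocc).union
      (hN.image2 hP app_injective2 hocc) ?_) ?_
    · rw [Set.disjoint_left]
      rintro _ ⟨a, ha, b, hb, rfl⟩ ⟨a', ha', b', hb', h⟩
      obtain ⟨rfl, rfl⟩ := app_injective2 h
      exact Option.some_ne_none _ (ha'.symm.trans ha)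
    · rw [Set.disjoint_left]
      rintro _ hx (⟨a, ha, b, hb, rfl⟩ | ⟨a, ha, b, hb, rfl⟩)
      · exact (hdisj _ _ hx).1 ha
      · exact (hdisj _ _ hx).2 hb
  have hNeq := hN.unique hsum
  have hS := centralSeries_eq
  have : N = centralSeries * F := by
    linear_combination centralSeries * hNeq - N * hS
  rwa [this] at hN

/-- The terms over `t`, counted by erased leaves: each of the `t.size` edges of `t` (the one above the
root included) carries its own sequence of binary trees. -/
theorem hasGF_strip_eq_some {t : LamTerm} {k : ℕ} (ht : t.ClosedUnder k) :
    HasGF {u : LamTerm | u.strip k = some t} (fun u => u.occ k) (centralSeries ^ t.size) := by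
  induction t generalizing k with
  | var i =>
    have hik : i ≠ k := ne_of_lt ht
    have hT := HasGF.singleton (w := fun u : LamTerm => u.occ k) (var i)
    have h := hasGF_strip_eq_some_of_root ht hT ?_ ?_
    · simpa [occ, hik, size] using h
    · ext u
      simp only [Set.mem_ofPred_eq, Set.mem_union, Set.mem_image2, Set.mem_singleton_iff]
      cases u with
      | var j =>
        by_cases hj : j = k
        · simp [strip, hj, hik.symm]
        · simp [strip, hj]
      | lam u => simp [strip_lam_eq_some ht]
      | app u v => simp [strip_app_eq_some]
    · intro a b h
      cases h
  | lam t ih =>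
    have hT := (ih (k := k + 1) ht).image (w' := fun u => u.occ k) (c := 0) lam_injective
      fun _ _ => rfl
    have h := hasGF_strip_eq_some_of_root ht hT ?_ ?_
    · simpa [size, pow_succ'] using h
    · ext u
      simp only [Set.mem_ofPred_eq, Set.mem_union, Set.mem_image2, Set.mem_image]
      cases u with
      | var j =>
        by_cases hj : j = k <;> simp [strip, hj]
      | lam u => simp [strip_lam_eq_some ht]
      | app u v => simp [strip_app_eq_some]
    · rintro a b ⟨_, _, h⟩
      cases h
  | app t s iht ihs =>
    have hT := (iht ht.1).image2 (u := fun u => u.occ k) (c := 0) (ihs ht.2) app_injective2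
      fun _ _ => rfl
    have h := hasGF_strip_eq_some_of_root ht hT ?_ ?_
    · have e : centralSeries ^ (app t s).size =
          centralSeries * (X ^ 0 * (centralSeries ^ t.size * centralSeries ^ s.size)) := by
        rw [size, pow_succ, pow_add]
        ring
      rwa [e]
    · ext u
      simp only [Set.mem_ofPred_eq, Set.mem_union, Set.mem_image2]
      cases u with
      | var j =>
        by_cases hj : j = k <;> simp [strip, hj]
      | lam u => simp [strip_lam_eq_some ht]
      | app u v =>
        simp only [strip_app_eq_some, app.injEq]
        constructor
        · rintro (⟨h1, h2⟩ | ⟨h1, h2⟩ | ⟨a, b, h1, h2, rfl, rfl⟩)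
          · exact Or.inr (Or.inl ⟨_, h1, _, h2, rfl, rfl⟩)
          · exact Or.inr (Or.inr ⟨_, h1, _, h2, rfl, rfl⟩)
          · exact Or.inl ⟨_, h1, _, h2, rfl, rfl⟩
        · rintro (⟨_, h1, _, h2, rfl, rfl⟩ | ⟨_, h1, _, h2, rfl, rfl⟩ | ⟨_, h1, _, h2, rfl, rfl⟩)
          · exact Or.inr (Or.inr ⟨_, _, h1, h2, rfl, rfl⟩)
          · exact Or.inl ⟨h1, h2⟩
          · exact Or.inr (Or.inl ⟨h1, h2⟩)
    · rintro a b ⟨a', ha, b', hb, h⟩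
      obtain ⟨rfl, rfl⟩ := app_injective2 h
      rw [Set.mem_ofPred_eq] at ha hb
      simp [ha, hb]

end LamTerm

open LamTerm

/-! ### The decomposition of `BCI(p)` -/

theorem finite_BCIOfSize (p n : ℕ) : (BCIOfSize p n).Finite :=
  (finite_closedUnder_size_le n 0).subset fun _ ht => ⟨ht.1.1, ht.2.le⟩

theorem hasGF_BCI (p : ℕ) : HasGF (BCI p) size (bciGF p) :=
  HasGF.of_finite (finite_BCIOfSize p)

/-- The terms of `BCI(p)` whose root is a unary node, all of the other nodes being leaves and binary
nodes. -/
theorem hasGF_lam_strip_eq_none {p : ℕ} (hp : 1 ≤ p) :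
    HasGF (lam '' {u | u.strip 0 = none ∧ u.occ 0 = p}) size
      (C (catalan (p - 1) : ℚ) * X ^ (2 * p)) := by
  have hsize : ∀ u ∈ {u : LamTerm | u.strip 0 = none ∧ u.occ 0 = p}, (lam u).size = 2 * p := by
    rintro u ⟨hu, hocc⟩
    have := (of_strip_eq_none 0 hu).2.2.1
    rw [size]
    omega
  obtain ⟨hfin, hcard⟩ := hasGF_strip_eq_none 0 p
  obtain ⟨q, rfl⟩ := Nat.exists_eq_add_of_le' hp
  rw [binaryTreeSeries, coeff_succ_X_mul, coeff_map, catalanSeries_coeff] at hcard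
  intro n
  rw [coeff_C_mul, coeff_X_pow]
  split_ifs with hn
  · have e : {v ∈ lam '' {u | u.strip 0 = none ∧ u.occ 0 = q + 1} | v.size = n} =
        lam '' {u | u.strip 0 = none ∧ u.occ 0 = q + 1} := by
      ext v
      refine ⟨fun h => h.1, fun h => ⟨h, ?_⟩⟩
      obtain ⟨u, hu, rfl⟩ := h
      exact (hsize u hu).trans hn.symm
    rw [e, Set.ncard_image_of_injective _ lam_injective]
    exact ⟨hfin.image _, by simpa using hcard⟩
  · have e : {v ∈ lam '' {u | u.strip 0 = none ∧ u.occ 0 = q + 1} | v.size = n} = ∅ := by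
      ext v
      simp only [Set.mem_ofPred_eq, Set.mem_empty_iff_false, iff_false]
      rintro ⟨⟨u, hu, rfl⟩, h⟩
      exact hn (h.symm.trans (hsize u hu))
    rw [e]
    simp

/-- The terms `lam u` of `BCI(p)` such that erasing in `u` the leaves bound by the root leaves another
term of `BCI(p)`. -/
theorem hasGF_lam_strip_mem_BCI {p : ℕ} (hp : 1 ≤ p) :
    HasGF (lam '' {u | (∃ t ∈ BCI p, u.strip 0 = some t) ∧ u.occ 0 = p}) size
      (bciDelta p (bciGF p)) := by
  classical
  set A := {u : LamTerm | (∃ t ∈ BCI p, u.strip 0 = some t) ∧ u.occ 0 = p}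
  have hsize : ∀ u t : LamTerm, t ∈ BCI p → u.strip 0 = some t → u.occ 0 = p →
      (lam u).size = t.size + (2 * p + 1) := by
    intro u t ht hu hocc
    have := (of_strip_eq_some 0 hu ht.1).2.2.1
    rw [size]
    omega
  intro n
  rw [coeff_bciDelta hp]
  split_ifs with hn
  · obtain ⟨m, rfl⟩ := Nat.exists_eq_add_of_le' hn
    rw [Nat.add_sub_cancel]
    have hG := hasGF_BCI p m
    -- The terms in question are fibred over the terms of size `m`.
    have hfib : ∀ t ∈ hG.1.toFinset, {u : LamTerm | u.strip 0 = some t ∧ u.occ 0 = p}.Finite ∧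
        (({u : LamTerm | u.strip 0 = some t ∧ u.occ 0 = p}.ncard : ℕ) : ℚ) =
          coeff p (centralSeries ^ m) := by
      intro t ht
      rw [Set.Finite.mem_toFinset] at ht
      have := hasGF_strip_eq_some ht.1.1 p
      rwa [ht.2] at this
    have e : {v ∈ lam '' A | v.size = m + (2 * p + 1)} =
        lam '' ⋃ t ∈ hG.1.toFinset, {u : LamTerm | u.strip 0 = some t ∧ u.occ 0 = p} := by
      ext v
      constructor
      · rintro ⟨⟨u, ⟨⟨t, ht, hu⟩, hocc⟩, rfl⟩, hs⟩
        refine ⟨u, Set.mem_biUnion (x := t) ?_ ⟨hu, hocc⟩, rfl⟩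
        have := hsize u t ht hu hocc
        simp only [Set.Finite.coe_toFinset]
        exact ⟨ht, by omega⟩
      · rintro ⟨u, hu, rfl⟩
        simp only [Set.mem_iUnion, Set.Finite.mem_toFinset] at hu
        obtain ⟨t, ht, hu, hocc⟩ := hu
        have := hsize u t ht.1 hu hocc
        have := ht.2
        exact ⟨⟨u, ⟨⟨t, ht.1, hu⟩, hocc⟩, rfl⟩, by omega⟩
    have hfin : (⋃ t ∈ hG.1.toFinset, {u : LamTerm | u.strip 0 = some t ∧ u.occ 0 = p}).Finite :=
      Set.Finite.biUnion (Finset.finite_toSet _) fun t ht => (hfib t ht).1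
    rw [e, Set.ncard_image_of_injective _ lam_injective]
    refine ⟨hfin.image _, ?_⟩
    have hcount : hfin.toFinset.card =
        ∑ t ∈ hG.1.toFinset, {u : LamTerm | u.strip 0 = some t ∧ u.occ 0 = p}.ncard := by
      rw [Finset.card_eq_sum_card_fiberwise (f := fun u : LamTerm => u.strip 0)
        (t := hG.1.toFinset.image some), Finset.sum_image fun _ _ _ _ h => Option.some.inj h]
      · refine Finset.sum_congr rfl fun t ht => ?_
        rw [← Set.ncard_coe_finset]
        congr 1
        ext u
        simp only [Finset.coe_filter, Set.Finite.mem_toFinset, Set.mem_iUnion, Set.mem_ofPred_eq]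
        constructor
        · rintro ⟨⟨t', ht', hu, hocc⟩, hu'⟩
          exact ⟨hu', hocc⟩
        · rintro ⟨hu, hocc⟩
          exact ⟨⟨t, by simpa using ht, hu, hocc⟩, hu⟩
      · intro u hu
        simp only [Set.Finite.coe_toFinset, Set.mem_iUnion] at hu
        obtain ⟨t, ht, hu, _⟩ := hu
        simp only [Finset.coe_image, Set.mem_image]
        exact ⟨t, ht, hu.symm⟩
    rw [Set.ncard_eq_toFinset_card _ hfin, hcount, Nat.cast_sum,
      Finset.sum_congr rfl fun t ht => (hfib t ht).2, Finset.sum_const, nsmul_eq_mul,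
      ← Set.ncard_eq_toFinset_card _ hG.1, hG.2, mul_comm]
  · have e : {v ∈ lam '' A | v.size = n} = ∅ := by
      ext v
      simp only [Set.mem_ofPred_eq, Set.mem_empty_iff_false, iff_false]
      rintro ⟨⟨u, ⟨⟨t, ht, hu⟩, hocc⟩, rfl⟩, h⟩
      have := hsize u t ht hu hocc
      omega
    rw [e]
    simp

theorem BCI_eq {p : ℕ} (hp : 1 ≤ p) :
    BCI p = lam '' {u | u.strip 0 = none ∧ u.occ 0 = p} ∪ Set.image2 app (BCI p) (BCI p) ∪
      lam '' {u | (∃ t ∈ BCI p, u.strip 0 = some t) ∧ u.occ 0 = p} := by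
  ext v
  constructor
  · rintro ⟨hc, hb⟩
    cases v with
    | var i => exact absurd hc (Nat.not_lt_zero i)
    | lam u =>
      cases hu : u.strip 0 with
      | none => exact Or.inl (Or.inl ⟨u, ⟨hu, hb.1⟩, rfl⟩)
      | some t =>
        have ht := closedUnder_of_strip_eq_some hp hu hc hb.2
        exact Or.inr ⟨u, ⟨⟨t, ⟨ht, (of_strip_eq_some p hu ht).2.1.1 hb.2⟩, hu⟩, hb.1⟩, rfl⟩
    | app t u => exact Or.inl (Or.inr ⟨t, ⟨hc.1, hb.1⟩, u, ⟨hc.2, hb.2⟩, rfl⟩)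
  · rintro ((⟨u, ⟨hu, hocc⟩, rfl⟩ | ⟨t, ht, u, hu, rfl⟩) | ⟨u, ⟨⟨t, ht, hu⟩, hocc⟩, rfl⟩)
    · obtain ⟨h1, h2, _⟩ := of_strip_eq_none p hu
      exact ⟨h1, hocc, h2⟩
    · exact ⟨⟨ht.1, hu.1⟩, ht.2, hu.2⟩
    · obtain ⟨h1, h2, _⟩ := of_strip_eq_some p hu ht.1
      exact ⟨h1, hocc, h2.2 ht.2⟩

theorem mainTheorem2 (p : ℕ) (hp : 1 ≤ p) :
    (∀ n : ℕ, (BCIOfSize p n).Finite) ∧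
      bciGF p = PowerSeries.C (catalan (p - 1) : ℚ) * (PowerSeries.X : PowerSeries ℚ) ^ (2 * p)
        + PowerSeries.X * bciGF p ^ 2 + bciDelta p (bciGF p) := by
  refine ⟨finite_BCIOfSize p, ?_⟩
  have hG := hasGF_BCI p
  have happ := hG.image2 (u := size) (c := 1) hG app_injective2 fun _ _ => rfl
  rw [← pow_two, pow_one] at happ
  refine hG.unique ?_
  rw [BCI_eq hp]
  refine ((hasGF_lam_strip_eq_none hp).union happ ?_).union (hasGF_lam_strip_mem_BCI hp) ?_
  · rw [Set.disjoint_left]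
    rintro _ ⟨u, _, rfl⟩ ⟨_, _, _, _, h⟩
    cases h
  · rw [Set.disjoint_left]
    rintro _ (⟨u, hu, rfl⟩ | ⟨_, _, _, _, rfl⟩) ⟨u', ⟨⟨t, _, hu'⟩, _⟩, h⟩
    · rw [lam_injective h, hu.1] at hu'
      cases hu'
    · cases h
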